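/- **Theorem 1.6.** Let $d$ be a positive squarefree integer and $K=\mathbb{Q}(\sqrt{-d})\subset\mathbb{C}$, with ring of integers $\mathcal{O}_K$. Suppose that $K$ has class number $2$ or that $$d\in\{5,6,10,13,15,22,35,37,51,58,91,115,123,187,235,267,403,427\}$$ (by the classification of imaginary quadratic fields of class number $2$ these conditions are equivalent). Identify $\mathbb{C}$ with the Euclidean plane $\mathbb{R}^2$. Let $L_{\mathfrak{o}}=\mathcal{O}_K\subset\mathbb{R}^2$ be the lattice of the principal class, and let $L_{\mathfrak{a}}=N(A)^{-1/2}A\subset\mathbb{R}^2$ be the lattice of the nonprincipal class $\mathfrak{a}$, where $A$ is any fractional ideal in $\mathfrak{a}$ and $N(A)$ is its norm (up to isometry $L_{\mathfrak{a}}$ does not depend on $A$; for $A=\mathbb{Z}\alpha+\mathbb{Z}\beta$ it is the lattice of the binary quadratic form $(\alpha\bar\alpha x^2+(\alpha\bar\beta+\bar\alpha\beta)xy+\beta\bar\beta y^2)/N(A)$). For a lattice $\Lambda\subset\mathbb{R}^2$ and a real number $m>0$, the shell of norm $m$ is $\Lambda_m=\{x\in\Lambda : (x,x)=m\}$. A finite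 nonempty set $X$ on a circle of radius $r>0$ centred at the origin is a spherical $2$-design if for every real polynomial $f$ in two variables of degree at most $2$ the average of $f$ over $\frac1r X$ equals its average over the unit circle. Then for every real $m>0$: if $(L_{\mathfrak{o}})_m\neq\emptyset$, then $(L_{\mathfrak{o}})_m$ is not a spherical $2$-design; and if $(L_{\mathfrak{a}})_m\neq\emptyset$, then $(L_{\mathfrak{a}})_m$ is not a spherical $2$-design. -/

import Mathlib

open MeasureTheory NumberField IntermediateField
open scoped nonZeroDivisors

noncomputable section

/-- A finite nonempty set `X` on some sphere of radius `r > 0` centred at the origin of `ℝⁿ` is a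
spherical `t`-design if, after rescaling `X` to the unit sphere, the average over `X` of every real
polynomial of total degree at most `t` equals its average over the unit sphere with respect to the
surface measure. -/
def IsSphericalDesign {n : ℕ} (t : ℕ) (X : Set (EuclideanSpace ℝ (Fin n))) : Prop :=
  ∃ Y : Finset (EuclideanSpace ℝ (Fin n)), (Y : Set (EuclideanSpace ℝ (Fin n))) = X ∧ Y.Nonempty ∧
    ∃ r : ℝ, 0 < r ∧ (∀ x ∈ Y, ‖x‖ = r) ∧
      ∀ f : MvPolynomial (Fin n) ℝ, f.totalDegree ≤ t →
        (1 / (Y.card : ℝ)) * ∑ x ∈ Y, MvPolynomial.eval (fun i => x i / r) f =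
          (1 / (volume : Measure (EuclideanSpace ℝ (Fin n))).toSphere.real Set.univ) *
            ∫ u : Metric.sphere (0 : EuclideanSpace ℝ (Fin n)) 1,
              MvPolynomial.eval (fun i => (u : EuclideanSpace ℝ (Fin n)) i) f
              ∂(volume : Measure (EuclideanSpace ℝ (Fin n))).toSphere

/-- The shell of norm `m` of a lattice: its vectors `x` with `(x, x) = m`. -/
def shell {n : ℕ} (Λ : AddSubgroup (EuclideanSpace ℝ (Fin n))) (m : ℝ) :
    Set (EuclideanSpace ℝ (Fin n)) :=
  {x | x ∈ Λ ∧ inner ℝ x x = m}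

/-- The field `ℚ(√-d)`, as a subfield of `ℂ`. -/
abbrev imagQuadField (d : ℕ) : IntermediateField ℚ ℂ :=
  ℚ⟮((Real.sqrt d : ℝ) : ℂ) * Complex.I⟯

instance imagQuadField_numberField (d : ℕ) : NumberField (imagQuadField d) where
  to_charZero := inferInstance
  to_finiteDimensional := by
    apply adjoin.finiteDimensional
    refine ⟨Polynomial.X ^ 2 + Polynomial.C (d : ℚ),
      Polynomial.monic_X_pow_add_C _ two_ne_zero, ?_⟩
    have h : (((Real.sqrt d : ℝ) : ℂ)) ^ 2 = (d : ℂ) := by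
      rw [← Complex.ofReal_pow, Real.sq_sqrt (Nat.cast_nonneg d)]
      simp
    simp [mul_pow, h]

/-- The inclusion `ℚ(√-d) ⊆ ℂ = ℝ²`, with `a + b i` identified with `(a, b)`, as an additive map. -/
def planeEmbedding (d : ℕ) : imagQuadField d →+ EuclideanSpace ℝ (Fin 2) where
  toFun z := !₂[(z : ℂ).re, (z : ℂ).im]
  map_zero' := by ext i; fin_cases i <;> simp
  map_add' x y := by ext i; fin_cases i <;> simp

/-- The lattice `N(A)^(-1/2) A` in the plane attached to a nonzero fractional ideal `A` of
`ℚ(√-d)`. If `A = ℤα + ℤβ`, then on the basis given by `α` and `β` its norm form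
`(x, y) ↦ (v, v)`, `v = N(A)^(-1/2) (xα + yβ)`, is the binary quadratic form
`(αα' x² + (αβ' + α'β) x y + ββ' y²) / N(A)` attached to `A`. Up to isometry it depends only on the
ideal class of `A`. -/
def idealLattice (d : ℕ) (A : (FractionalIdeal (𝓞 (imagQuadField d))⁰ (imagQuadField d))ˣ) :
    AddSubgroup (EuclideanSpace ℝ (Fin 2)) :=
  ((A : FractionalIdeal (𝓞 (imagQuadField d))⁰ (imagQuadField d)) :
      Submodule (𝓞 (imagQuadField d)) (imagQuadField d)).toAddSubgroup.map
    ((DistribSMul.toAddMonoidHom (EuclideanSpace ℝ (Fin 2))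
      (Real.sqrt (FractionalIdeal.absNorm
        (A : FractionalIdeal (𝓞 (imagQuadField d))⁰ (imagQuadField d)) : ℝ))⁻¹).comp
      (planeEmbedding d))

/-- The ring of integers of `ℚ(√-d)` as a lattice in the plane. -/
def integersLattice (d : ℕ) : AddSubgroup (EuclideanSpace ℝ (Fin 2)) :=
  (algebraMap (𝓞 (imagQuadField d)) (imagQuadField d)).range.toAddSubgroup.map (planeEmbedding d)

end

/-!
Write `σ` for complex conjugation. If a shell of a rescaled ideal `c I` were a spherical `2`-design,
the polynomials `x² - y²` and `x y` would show that the sum of `α²` over the elements `α ∈ I` of the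
corresponding norm is `0` (`IsSphericalDesign.sum_sq_eq_zero`). This sum is never `0`.

The class number enters only through this consequence: every prime `P` of `K = ℚ(√-d)` is equivalent
to `σ(P)`. For class number `2` this holds because conjugation fixes the principal class
(`conj_class_of_classNumber_eq_two`). For the listed `d` it follows from Gauss reduction: dividing an
ideal by a shortest element gives a lattice with a reduced basis, and for these discriminants every
reduced form is ambiguous, so the lattice is similar to its conjugate (`exists_conj_mem_iff_mul_mem`,
`reduced_forms_ambiguous`). The same reduction shows that `ℚ(i)` and `ℚ(√-3)` have class number `1`;
in all other fields the only integers of norm `1` are `±1`.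

Hence for each `P ≠ σ(P)` there is `u ∈ K` of norm `1` with `(u) = P⁻¹ σ(P)`. Elements of norm `m` in
an ideal are determined up to sign by their orders at the primes; the order at `P` runs through an
interval independently of the other primes, because multiplication by `u` lowers it by one and
compensates at `σ(P)`. So the sum of squares is, up to a nonzero factor, a product of geometric sums
`1 + u² + ⋯ + u²ᵏ`. None of these vanishes, since `u` is not a root of unity
(`sum_sq_ne_zero_of_ord`, by induction on the number of elements).
-/

/-! ### Sums of squares of elements of given norm -/

/-- The combinatorial core: `Y` is the set of elements of norm `m` in the "box" `a P ≤ ord P`, and its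
sum of squares is not zero. If the orders of the elements of `Y` all agree, `Y ⊆ {x, -x}`. If they
differ at `P`, let `Y'` be the elements with the largest order at `P`. Multiplication by the element
`u` of norm `1` that moves one unit of order from `P` to its conjugate splits `Y` into translates
`u ^ i Y'` for `i = 0, …, k`, so the sum of squares of `Y` is a geometric sum in `u ^ 2` times that
of `Y'`, a smaller set of the same kind. -/
theorem sum_sq_ne_zero_of_ord {K ι : Type*} [Field K] [CharZero K] (σ : K → K)
    (σ_mul : ∀ x y, σ (x * y) = σ x * σ y) (ord : ι → K → ℤ) (bar : ι → ι)
    (ord_mul : ∀ P x y, x ≠ 0 → y ≠ 0 → ord P (x * y) = ord P x + ord P y)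
    (ord_conj : ∀ P x, x ≠ 0 → ord P (σ x) = ord (bar P) x)
    (eq_or_neg : ∀ x y, x ≠ 0 → y ≠ 0 → x * σ x = y * σ y → (∀ P, ord P x = ord P y) →
      x = y ∨ x = -y)
    (exists_shift : ∀ P, bar P ≠ P → ∃ u, u ≠ 0 ∧ u * σ u = 1 ∧ ord P u = -1 ∧
      ord (bar P) u = 1 ∧ ∀ Q, Q ≠ P → Q ≠ bar P → ord Q u = 0)
    (m : K) (hm : m ≠ 0) (a : ι → ℤ) (Y : Finset K)
    (hY : ∀ x, x ∈ Y ↔ x ≠ 0 ∧ x * σ x = m ∧ ∀ P, a P ≤ ord P x) (hne : Y.Nonempty) :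
    ∑ x ∈ Y, x ^ 2 ≠ 0 := by
  classical
  have ord_one : ∀ P, ord P 1 = 0 := fun P => by
    have := ord_mul P 1 1 one_ne_zero one_ne_zero
    rw [one_mul] at this
    lia
  have ord_pow : ∀ P x (n : ℕ), x ≠ 0 → ord P (x ^ n) = n * ord P x := fun P x n hx => by
    induction n with
    | zero => simp [ord_one]
    | succ n ih =>
      rw [pow_succ, ord_mul P _ _ (pow_ne_zero n hx) hx, ih]
      push_cast
      ring
  have ord_inv : ∀ P x, x ≠ 0 → ord P x⁻¹ = -ord P x := fun P x hx => by
    have := ord_mul P x x⁻¹ hx (inv_ne_zero hx)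
    rw [mul_inv_cancel₀ hx, ord_one] at this
    lia
  -- The orders at `P` and at its conjugate determine each other on elements of norm `m`.
  have ord_add_bar : ∀ P x, x ≠ 0 → x * σ x = m → ord P x + ord (bar P) x = ord P m :=
    fun P x hx hxm => by
      have hσ : σ x ≠ 0 := right_ne_zero_of_mul (hxm ▸ hm)
      rw [← hxm, ord_mul P _ _ hx hσ, ord_conj P x hx]
  induction hn : Y.card using Nat.strong_induction_on generalizing Y a with
  | _ n ih =>
  by_cases hall : ∀ x ∈ Y, ∀ y ∈ Y, ∀ P, ord P x = ord P y
  · obtain ⟨x, hx⟩ := hne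
    have hsq : ∀ y ∈ Y, y ^ 2 = x ^ 2 := fun y hy => by
      have h1 := (hY x).1 hx
      have h2 := (hY y).1 hy
      rcases eq_or_neg y x h2.1 h1.1 (h2.2.1.trans h1.2.1.symm) (hall y hy x hx) with h | h <;>
        simp [h]
    rw [Finset.sum_congr rfl hsq, Finset.sum_const, nsmul_eq_mul]
    exact mul_ne_zero (Nat.cast_ne_zero.2 (Finset.card_ne_zero_of_mem hx))
      (pow_ne_zero 2 ((hY x).1 hx).1)
  push Not at hall
  obtain ⟨x₀, hx₀, y₀, hy₀, P, hP⟩ := hall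
  -- At a self-conjugate prime the order of an element of norm `m` is half that of `m`.
  have hbar : bar P ≠ P := fun h => by
    have h1 := ord_add_bar P x₀ ((hY x₀).1 hx₀).1 ((hY x₀).1 hx₀).2.1
    have h2 := ord_add_bar P y₀ ((hY y₀).1 hy₀).1 ((hY y₀).1 hy₀).2.1
    rw [h] at h1 h2
    lia
  obtain ⟨u, hu, hu1, huP, huB, huQ⟩ := exists_shift P hbar
  have hu1' : ∀ i : ℕ, u ^ i * σ (u ^ i) = 1 := fun i => by
    induction i with
    | zero =>
      have h := σ_mul 1 u
      rw [one_mul] at h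
      have : σ u ≠ 0 := right_ne_zero_of_mul (hu1 ▸ one_ne_zero)
      simpa using (mul_eq_right₀ this).1 h.symm
    | succ i ih => rw [pow_succ, σ_mul, mul_mul_mul_comm, ih, hu1, one_mul]
  obtain ⟨γ, hγ, hmax⟩ := Y.exists_max_image (ord P) hne
  obtain ⟨δ, hδ, hmin⟩ := Y.exists_min_image (ord P) hne
  set b := ord P γ with hb
  obtain ⟨k, hk⟩ : ∃ k : ℕ, ord P δ = b - k := ⟨(b - ord P δ).toNat, by have := hmax δ hδ; lia⟩
  have hkmin : ∀ x ∈ Y, b - k ≤ ord P x := fun x hx => hk ▸ hmin x hx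
  set Y' := Y.filter (fun x => ord P x = b) with hY'
  have hmem : ∀ x, x ∈ Y' ↔ x ≠ 0 ∧ x * σ x = m ∧ ∀ Q, Function.update a P b Q ≤ ord Q x := by
    intro x
    rw [hY', Finset.mem_filter, hY]
    constructor
    · rintro ⟨⟨h0, h1, h2⟩, h3⟩
      refine ⟨h0, h1, fun Q => ?_⟩
      by_cases hQ : Q = P
      · subst hQ; simp [h3]
      · simp [hQ, h2]
    · rintro ⟨h0, h1, h2⟩
      have hxY : x ∈ Y := by
        refine (hY x).2 ⟨h0, h1, fun Q => ?_⟩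
        by_cases hQ : Q = P
        · have := h2 P
          rw [Function.update_self] at this
          exact hQ ▸ (((hY γ).1 hγ).2.2 P).trans this
        · simpa [hQ] using h2 Q
      refine ⟨(hY x).1 hxY, le_antisymm (hmax x hxY) ?_⟩
      simpa using h2 P
  have hlt : Y'.card < n := by
    rw [← hn]
    refine Finset.card_lt_card (Finset.filter_ssubset.2 ?_)
    by_contra! h
    exact hP ((h x₀ hx₀).trans (h y₀ hy₀).symm)
  have hS' := ih _ hlt (Function.update a P b) Y' hmem ⟨γ, by simp [hY', hγ, hb]⟩ rfl
  have hord : ∀ i : ℕ, ord P (u ^ i) = -i := fun i => by rw [ord_pow _ _ _ hu, huP]; ring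
  have hordB : ∀ i : ℕ, ord (bar P) (u ^ i) = i := fun i => by rw [ord_pow _ _ _ hu, huB]; ring
  have hordQ : ∀ i : ℕ, ∀ Q, Q ≠ P → Q ≠ bar P → ord Q (u ^ i) = 0 := fun i Q h1 h2 => by
    rw [ord_pow _ _ _ hu, huQ Q h1 h2]; ring
  have hσ1 : ∀ z y : K, z * σ z = 1 → z * y * σ (z * y) = y * σ y := fun z y hz => by
    rw [σ_mul, mul_mul_mul_comm, hz, one_mul]
  have hsum : ∑ x ∈ Y, x ^ 2 = (∑ i ∈ Finset.range (k + 1), (u ^ 2) ^ i) * ∑ x ∈ Y', x ^ 2 := by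
    rw [Finset.sum_mul_sum, ← Finset.sum_product']
    symm
    refine Finset.sum_bij' (fun p _ => u ^ p.1 * p.2)
      (fun x _ => ((b - ord P x).toNat, (u ^ (b - ord P x).toNat)⁻¹ * x)) ?_ ?_ ?_ ?_ ?_
    · rintro ⟨i, x⟩ hp
      simp only [Finset.mem_product, Finset.mem_range, hY', Finset.mem_filter] at hp
      obtain ⟨hi, hxY, hxb⟩ := hp
      obtain ⟨h0, h1, h2⟩ := (hY x).1 hxY
      have hui : u ^ i ≠ 0 := pow_ne_zero i hu
      refine (hY _).2 ⟨mul_ne_zero hui h0, by rw [hσ1 _ _ (hu1' i), h1], fun Q => ?_⟩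
      rw [ord_mul Q _ _ hui h0]
      by_cases hQ : Q = P
      · subst hQ
        have := ((hY δ).1 hδ).2.2 Q
        rw [hord]
        lia
      by_cases hQ' : Q = bar P
      · subst hQ'
        have := h2 (bar P)
        rw [hordB]
        lia
      · rw [hordQ i Q hQ hQ', zero_add]
        exact h2 Q
    · intro x hx
      obtain ⟨h0, h1, h2⟩ := (hY x).1 hx
      have hle := hmax x hx
      have hge := hkmin x hx
      obtain ⟨i, hi⟩ : ∃ i : ℕ, b - ord P x = i := ⟨(b - ord P x).toNat, by lia⟩
      have hui : u ^ i ≠ 0 := pow_ne_zero i hu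
      have hm1 := ord_add_bar P x h0 h1
      have hm2 := ord_add_bar P γ ((hY γ).1 hγ).1 ((hY γ).1 hγ).2.1
      have hz : (u ^ i)⁻¹ * σ (u ^ i)⁻¹ = 1 := by
        have h := hσ1 (u ^ i) (u ^ i)⁻¹ (hu1' i)
        rw [mul_inv_cancel₀ hui] at h
        have h3 := hu1' 0
        rw [pow_zero] at h3
        rw [← h, h3]
      have hPx : ord P ((u ^ i)⁻¹ * x) = b := by
        rw [ord_mul P _ _ (inv_ne_zero hui) h0, ord_inv P _ hui, hord]
        lia
      simp only [hi, Int.toNat_natCast, Finset.mem_product, Finset.mem_range, hY',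
        Finset.mem_filter]
      refine ⟨by lia, (hY _).2 ⟨mul_ne_zero (inv_ne_zero hui) h0, by rw [hσ1 _ _ hz, h1],
        fun Q => ?_⟩, hPx⟩
      by_cases hQ : Q = P
      · subst hQ
        rw [hPx]
        exact ((hY γ).1 hγ).2.2 Q
      rw [ord_mul Q _ _ (inv_ne_zero hui) h0, ord_inv Q _ hui]
      by_cases hQ' : Q = bar P
      · subst hQ'
        have := ((hY γ).1 hγ).2.2 (bar P)
        rw [hordB]
        lia
      · rw [hordQ i Q hQ hQ', neg_zero, zero_add]
        exact h2 Q
    · rintro ⟨i, x⟩ hp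
      simp only [Finset.mem_product, Finset.mem_range, hY', Finset.mem_filter] at hp
      obtain ⟨hi, hxY, hxb⟩ := hp
      have hui : u ^ i ≠ 0 := pow_ne_zero i hu
      have : (b - ord P (u ^ i * x)).toNat = i := by
        rw [ord_mul P _ _ hui ((hY x).1 hxY).1, hord, hxb]
        lia
      simp only [this, inv_mul_cancel_left₀ hui]
    · intro x hx
      exact mul_inv_cancel_left₀ (pow_ne_zero _ hu) x
    · rintro ⟨i, x⟩ hp
      ring
  rw [hsum]
  refine mul_ne_zero (fun h0 => ?_) hS'
  -- If the geometric sum vanished, `u` would be a root of unity, but its order at `P` is `-1`.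
  have h1 := geom_sum_mul (u ^ 2) (k + 1)
  rw [h0, zero_mul, ← pow_mul] at h1
  have h2 := hord (2 * (k + 1))
  rw [(sub_eq_zero.1 h1.symm), ord_one] at h2
  push_cast at h2
  lia

/-! ### Orders at the primes of a Dedekind domain -/

section Dedekind

open IsDedekindDomain FractionalIdeal

/-- The preimage `τ⁻¹(P)` of a prime `P` under an automorphism `τ`. -/
def comapPrime {R : Type*} [CommRing R] (τ : R ≃+* R) (P : HeightOneSpectrum R) :
    HeightOneSpectrum R :=
  P.comap (τ : R →+* R) τ.surjective

theorem comapPrime_asIdeal {R : Type*} [CommRing R] (τ : R ≃+* R)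
    (P : HeightOneSpectrum R) :
    (comapPrime τ P).asIdeal = P.asIdeal.comap (τ : R →+* R) := rfl

theorem mem_comapPrime {R : Type*} [CommRing R] (τ : R ≃+* R) (P : HeightOneSpectrum R)
    (r : R) :
    r ∈ (comapPrime τ P).asIdeal ↔ τ r ∈ P.asIdeal := Iff.rfl

variable {R K : Type*} [CommRing R] [IsDedekindDomain R] [Field K] [Algebra R K]
  [IsFractionRing R K]

theorem le_count_spanSingleton_algebraMap_iff (P : HeightOneSpectrum R) {r : R} (hr : r ≠ 0)
    (n : ℕ) : (n : ℤ) ≤ count K P (spanSingleton R⁰ (algebraMap R K r)) ↔ r ∈ P.asIdeal ^ n := by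
  classical
  have hs : Ideal.span {r} ≠ 0 := Submodule.span_singleton_eq_bot.not.2 hr
  rw [← coeIdeal_span_singleton, count_coe K P hs, Nat.cast_le, ← Ideal.dvd_span_singleton,
    ← Associates.mk_le_mk_iff_dvd, Associates.mk_pow,
    Associates.prime_pow_dvd_iff_le (Associates.mk_ne_zero.2 hs) P.associates_irreducible]

theorem count_spanSingleton_mul (P : HeightOneSpectrum R) {x y : K} (hx : x ≠ 0) (hy : y ≠ 0) :
    count K P (spanSingleton R⁰ (x * y)) =
      count K P (spanSingleton R⁰ x) + count K P (spanSingleton R⁰ y) := by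
  rw [← spanSingleton_mul_spanSingleton, count_mul K P (spanSingleton_ne_zero_iff.2 hx)
    (spanSingleton_ne_zero_iff.2 hy)]

/-- The order of `σ x` at `P` is the order of `x` at the preimage of `P`. -/
theorem count_spanSingleton_ringEquiv (σ : K ≃+* K) (τ : R ≃+* R)
    (hστ : ∀ r, algebraMap R K (τ r) = σ (algebraMap R K r)) (P : HeightOneSpectrum R)
    {x : K} (hx : x ≠ 0) :
    count K P (spanSingleton R⁰ (σ x)) =
      count K (comapPrime τ P) (spanSingleton R⁰ x) := by
  have hint : ∀ r : R, r ≠ 0 → count K P (spanSingleton R⁰ (σ (algebraMap R K r))) =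
      count K (comapPrime τ P) (spanSingleton R⁰ (algebraMap R K r)) := by
    intro r hr
    have hτr : τ r ≠ 0 := by simpa using hr
    have h0 : 0 ≤ count K P (spanSingleton R⁰ (algebraMap R K (τ r))) := by
      rw [← coeIdeal_span_singleton]
      exact count_coe_nonneg K P _
    have h1 : 0 ≤ count K (comapPrime τ P)
        (spanSingleton R⁰ (algebraMap R K r)) := by
      rw [← coeIdeal_span_singleton]
      exact count_coe_nonneg K _ _
    rw [← hστ]
    obtain ⟨a, ha⟩ := Int.eq_ofNat_of_zero_le h0
    obtain ⟨b, hb⟩ := Int.eq_ofNat_of_zero_le h1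
    have key : ∀ n : ℕ, n ≤ a ↔ n ≤ b := fun n => by
      rw [← Int.ofNat_le, ← Int.ofNat_le (m := n) (n := b), ← ha, ← hb,
        le_count_spanSingleton_algebraMap_iff P hτr, le_count_spanSingleton_algebraMap_iff _ hr,
        comapPrime_asIdeal]
      have : P.asIdeal.comap (τ : R →+* R) = P.asIdeal.map (τ.symm : R →+* R) :=
        Ideal.comap_symm τ.symm
      have hpow : (P.asIdeal ^ n).map (τ.symm : R →+* R) =
          (P.asIdeal ^ n).comap (τ : R →+* R) := (Ideal.comap_symm τ.symm).symm
      rw [this, ← Ideal.map_pow, hpow]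
      rfl
    rw [ha, hb, le_antisymm ((key a).1 le_rfl) ((key b).2 le_rfl)]
  obtain ⟨r, s, hs, rfl⟩ := IsFractionRing.div_surjective (A := R) x
  have hs0 : s ≠ 0 := nonZeroDivisors.ne_zero hs
  have hr0 : r ≠ 0 := by rintro rfl; simp at hx
  have hsK : algebraMap R K s ≠ 0 := by simpa using hs0
  have e1 := count_spanSingleton_mul (comapPrime τ P) hx hsK
  have e2 := count_spanSingleton_mul P (x := σ (algebraMap R K r / algebraMap R K s))
    (y := σ (algebraMap R K s)) (by simpa using hx) (by simpa using hs0)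
  rw [← map_mul] at e2
  rw [div_mul_cancel₀ _ hsK] at e1 e2
  rw [hint r hr0, hint s hs0] at e2
  lia

theorem fractionalIdeal_le_one_iff_count_nonneg {I : FractionalIdeal R⁰ K} (hI : I ≠ 0) :
    I ≤ 1 ↔ ∀ P : HeightOneSpectrum R, 0 ≤ count K P I := by
  refine ⟨fun h P => (count_one K P).symm.le.trans (count_mono K P hI h), fun h => ?_⟩
  rw [← finprod_heightOneSpectrum_factorization' K hI]
  refine finprod_induction (· ≤ (1 : FractionalIdeal R⁰ K)) le_rfl
    (fun x y hx hy => mul_le_one' hx hy) fun P => ?_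
  obtain ⟨n, hn⟩ := Int.eq_ofNat_of_zero_le (h P)
  rw [hn, zpow_natCast]
  exact pow_le_one' coeIdeal_le_one n

theorem mem_fractionalIdeal_iff_count_le {I : FractionalIdeal R⁰ K} (hI : I ≠ 0) {x : K}
    (hx : x ≠ 0) :
    x ∈ I ↔ ∀ P : HeightOneSpectrum R, count K P I ≤ count K P (spanSingleton R⁰ x) := by
  have hx' : spanSingleton R⁰ x ≠ 0 := spanSingleton_ne_zero_iff.2 hx
  rw [← spanSingleton_le_iff_mem]
  have h1 : spanSingleton R⁰ x ≤ I ↔ spanSingleton R⁰ x * I⁻¹ ≤ 1 := by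
    constructor <;> intro h
    · simpa [mul_inv_cancel₀ hI] using mul_le_mul_left h I⁻¹
    · simpa [mul_assoc, inv_mul_cancel₀ hI] using mul_le_mul_left h I
  rw [h1, fractionalIdeal_le_one_iff_count_nonneg (mul_ne_zero hx' (inv_ne_zero hI))]
  refine forall_congr' fun P => ?_
  rw [count_mul K P hx' (inv_ne_zero hI), count_inv]
  lia

theorem mem_range_algebraMap_of_count_nonneg {x : K} (hx : x ≠ 0)
    (h : ∀ P : HeightOneSpectrum R, 0 ≤ count K P (spanSingleton R⁰ x)) :
    x ∈ (algebraMap R K).range := by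
  have := (mem_fractionalIdeal_iff_count_le (I := (1 : FractionalIdeal R⁰ K)) one_ne_zero hx).2
    fun P => (count_one K P).le.trans (h P)
  obtain ⟨r, hr⟩ := (mem_one_iff R⁰).1 this
  exact ⟨r, hr⟩

/-- If conjugate primes lie in the same ideal class and the only elements of norm `1` in `R` are `±1`,
then the elements of a given norm in a fractional ideal have nonzero sum of squares. A generator `u`
of the principal ideal `P⁻¹ σ(P)` has unit norm, which `norm_unit` turns into norm `1`; it is the
element that shifts the order from `P` to its conjugate. -/
theorem sum_sq_ne_zero_of_conj_class_eq [CharZero K] (σ : K ≃+* K) (τ : R ≃+* R)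
    (hστ : ∀ r, algebraMap R K (τ r) = σ (algebraMap R K r)) (hσ : ∀ x, σ (σ x) = x)
    (eq_one_or_neg_one : ∀ x ∈ (algebraMap R K).range, x * σ x = 1 → x = 1 ∨ x = -1)
    (norm_unit : ∀ u, u ≠ 0 → u * σ u ∈ (algebraMap R K).range →
      (u * σ u)⁻¹ ∈ (algebraMap R K).range → u * σ u = 1)
    (conj_class : ∀ P : HeightOneSpectrum R, ∃ u : K, u ≠ 0 ∧
      spanSingleton R⁰ u * (P.asIdeal : FractionalIdeal R⁰ K) =
        (comapPrime τ P).asIdeal)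
    (I : FractionalIdeal R⁰ K) (hI : I ≠ 0) (m : K) (hm : m ≠ 0) (Y : Finset K)
    (hY : ∀ x, x ∈ Y ↔ x ∈ I ∧ x * σ x = m) (hne : Y.Nonempty) : ∑ x ∈ Y, x ^ 2 ≠ 0 := by
  have hbar : ∀ P : HeightOneSpectrum R, comapPrime τ (comapPrime τ P) = P := fun P => by
    ext r
    have : τ (τ r) = r := IsFractionRing.injective R K (by rw [hστ, hστ, hσ])
    rw [mem_comapPrime, mem_comapPrime, this]
  refine sum_sq_ne_zero_of_ord σ (map_mul σ) (fun P x => count K P (spanSingleton R⁰ x))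
    (comapPrime τ)
    (fun P x y hx hy => count_spanSingleton_mul P hx hy)
    (fun P x hx => count_spanSingleton_ringEquiv σ τ hστ P hx) ?_ ?_ m hm
    (fun P => count K P I) Y (fun x => ?_) hne
  · intro x y hx hy hxy hord
    have hd : x / y ≠ 0 := div_ne_zero hx hy
    have h1 : x / y ∈ (algebraMap R K).range := by
      refine mem_range_algebraMap_of_count_nonneg hd fun P => ?_
      have := count_spanSingleton_mul P hd hy
      rw [div_mul_cancel₀ _ hy] at this
      have h2 : count K P (spanSingleton R⁰ x) = count K P (spanSingleton R⁰ y) := hord P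
      lia
    have hσy : σ y ≠ 0 := by simpa using hy
    have h2 : x / y * σ (x / y) = 1 := by
      rw [map_div₀, div_mul_div_comm, hxy, div_self (mul_ne_zero hy hσy)]
    rcases eq_one_or_neg_one _ h1 h2 with h | h
    · exact Or.inl (by simpa using (div_eq_iff hy).1 h)
    · exact Or.inr (by simpa using (div_eq_iff hy).1 h)
  · intro P hP
    obtain ⟨u, hu, huP⟩ := conj_class P
    have hcount : ∀ Q : HeightOneSpectrum R, count K Q (spanSingleton R⁰ u) +
        count K Q (P.asIdeal : FractionalIdeal R⁰ K) = count K Q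
          ((comapPrime τ P).asIdeal : FractionalIdeal R⁰ K) := fun Q => by
      rw [← huP, count_mul K Q (spanSingleton_ne_zero_iff.2 hu) (coeIdeal_ne_zero.2 P.ne_bot)]
    have h1 : count K P (spanSingleton R⁰ u) = -1 := by
      have := hcount P
      rw [count_self, count_maximal_coprime K _ hP] at this
      lia
    have h2 : count K (comapPrime τ P) (spanSingleton R⁰ u) = 1 := by
      have := hcount (comapPrime τ P)
      rw [count_self, count_maximal_coprime K _ hP.symm] at this
      lia
    have h3 : ∀ Q, Q ≠ P → Q ≠ comapPrime τ P →
        count K Q (spanSingleton R⁰ u) = 0 := fun Q hQ hQ' => by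
      have := hcount Q
      rw [count_maximal_coprime K _ hQ.symm, count_maximal_coprime K _ hQ'.symm] at this
      lia
    have hσu : σ u ≠ 0 := by simpa using hu
    have h4 : ∀ Q : HeightOneSpectrum R, count K Q (spanSingleton R⁰ (u * σ u)) = 0 := by
      intro Q
      rw [count_spanSingleton_mul Q hu hσu, count_spanSingleton_ringEquiv σ τ hστ Q hu]
      by_cases hQ : Q = P
      · rw [hQ, h1, h2]; rfl
      by_cases hQ' : Q = comapPrime τ P
      · rw [hQ', hbar, h1, h2]; rfl
      rw [h3 Q hQ hQ', h3 _ (fun h => hQ' ?_) (fun h => hQ ?_), add_zero]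
      · rw [← h, hbar]
      · rw [← hbar Q, h, hbar]
    have hN : u * σ u ≠ 0 := mul_ne_zero hu hσu
    refine ⟨u, hu, norm_unit u hu (mem_range_algebraMap_of_count_nonneg hN fun Q => (h4 Q).ge)
      (mem_range_algebraMap_of_count_nonneg (inv_ne_zero hN) fun Q => ?_), h1, h2, h3⟩
    rw [← spanSingleton_inv, count_inv, h4, neg_zero]
  · rw [hY]
    constructor
    · rintro ⟨h1, h2⟩
      have hx : x ≠ 0 := by rintro rfl; exact hm (by simpa using h2.symm)
      exact ⟨hx, h2, (mem_fractionalIdeal_iff_count_le hI hx).1 h1⟩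
    · rintro ⟨hx, h2, h1⟩
      exact ⟨(mem_fractionalIdeal_iff_count_le hI hx).2 h1, h2⟩

end Dedekind

/-! ### Reduction of plane lattices -/

section Reduction

open ComplexConjugate

theorem exists_int_of_mem_of_im_eq_zero {B : AddSubgroup ℂ} (h1 : (1 : ℂ) ∈ B)
    (hB : ∀ z ∈ B, z ≠ 0 → 1 ≤ Complex.normSq z) {z : ℂ} (hz : z ∈ B) (him : z.im = 0) :
    ∃ k : ℤ, z = k := by
  refine ⟨round z.re, ?_⟩
  by_contra hne
  have hk : ((round z.re : ℤ) : ℂ) ∈ B := by simpa using B.zsmul_mem h1 (round z.re)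
  have h2 := hB _ (B.sub_mem hz hk) (sub_ne_zero.2 hne)
  rw [Complex.normSq_apply] at h2
  simp only [Complex.sub_re, Complex.intCast_re, Complex.sub_im, Complex.intCast_im, him] at h2
  have h3 := abs_le.1 (abs_sub_round z.re)
  nlinarith

/-- Translating `z` by an integer into the strip `|re| ≤ 1/2` shows that a small imaginary part would
make a nonzero element shorter than `1`. -/
theorem half_le_im_of_mem {B : AddSubgroup ℂ} (h1 : (1 : ℂ) ∈ B)
    (hB : ∀ z ∈ B, z ≠ 0 → 1 ≤ Complex.normSq z) {z : ℂ} (hz : z ∈ B) (him : 0 < z.im) :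
    1 / 2 ≤ z.im := by
  by_contra! hlt
  have hk : ((round z.re : ℤ) : ℂ) ∈ B := by simpa using B.zsmul_mem h1 (round z.re)
  have h2 := hB _ (B.sub_mem hz hk) (fun h => by
    have := congrArg Complex.im h
    simp at this
    linarith)
  rw [Complex.normSq_apply] at h2
  simp only [Complex.sub_re, Complex.intCast_re, Complex.sub_im, Complex.intCast_im] at h2
  have h3 := abs_le.1 (abs_sub_round z.re)
  nlinarith

/-- Gauss reduction of a lattice `B` with shortest vector `1` and multiplication by `ω`, where
`ω ^ 2 = T ω - n`: it has a basis `1`, `(ω + t) / a` that corresponds to the reduced quadratic form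
with coefficients `a`, `2 t + T`, `(t ^ 2 + T t + n) / a`. -/
theorem exists_reduced_basis {B : AddSubgroup ℂ} (h1 : (1 : ℂ) ∈ B)
    (hB : ∀ z ∈ B, z ≠ 0 → 1 ≤ Complex.normSq z) {ω : ℂ} {T n : ℤ} (hre : ω.re = T / 2)
    (him : 0 < ω.im) (hn : Complex.normSq ω = n) (hω : ∀ z ∈ B, ω * z ∈ B) :
    ∃ a t : ℤ, 0 < a ∧ |2 * t + T| ≤ a ∧ a ^ 2 ≤ t ^ 2 + T * t + n ∧ a ∣ t ^ 2 + T * t + n ∧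
      ∀ z, z ∈ B ↔ ∃ k l : ℤ, z = k + l * ((ω + t) / a) := by
  have hωB : ω ∈ B := by simpa using hω 1 h1
  have hint : ∀ k : ℤ, (k : ℂ) ∈ B := fun k => by simpa using B.zsmul_mem h1 k
  -- The imaginary parts form a discrete, hence cyclic, group.
  obtain ⟨b, hb⟩ := AddSubgroup.cyclic_of_isolated_zero (H := B.map Complex.imAddGroupHom)
    (a := 1 / 2) (by norm_num) (Set.disjoint_left.2 (by
      rintro _ ⟨z, hz, rfl⟩ ⟨h2, h3⟩
      exact absurd h3 (not_lt.2 (half_le_im_of_mem h1 hB hz h2))))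
  have hb' : ∀ y : ℝ, (∃ z ∈ B, z.im = y) ↔ ∃ l : ℤ, l • b = y := fun y => by
    rw [← AddSubgroup.mem_closure_singleton, ← hb, AddSubgroup.mem_map]
    rfl
  obtain ⟨a, b, ha, hab, hb⟩ : ∃ (a : ℤ) (b : ℝ), 0 < a ∧ a * b = ω.im ∧
      ∀ y : ℝ, (∃ z ∈ B, z.im = y) ↔ ∃ l : ℤ, l * b = y := by
    obtain ⟨a, ha⟩ := (hb' ω.im).1 ⟨ω, hωB, rfl⟩
    rw [zsmul_eq_mul] at ha
    rcases lt_trichotomy a 0 with h | h | h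
    · refine ⟨-a, -b, by lia, by push_cast; linarith, fun y => (hb' y).trans ⟨?_, ?_⟩⟩
      · rintro ⟨l, rfl⟩
        exact ⟨-l, by push_cast; rw [zsmul_eq_mul]; ring⟩
      · rintro ⟨l, rfl⟩
        exact ⟨-l, by rw [zsmul_eq_mul]; push_cast; ring⟩
    · simp [h] at ha
      linarith
    · exact ⟨a, b, h, ha, fun y => by simpa using hb' y⟩
  obtain ⟨τ, hτ, hτb⟩ := (hb b).2 ⟨1, by simp⟩
  have haR : (a : ℝ) ≠ 0 := by exact_mod_cast ha.ne'
  have haC : (a : ℂ) ≠ 0 := by exact_mod_cast ha.ne'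
  obtain ⟨t₀, ht₀⟩ := exists_int_of_mem_of_im_eq_zero h1 hB
    (B.sub_mem (B.zsmul_mem hτ a) hωB) (by simp [hτb, hab])
  -- Translate `τ` so that its real part lies in `[-1/2, 1/2]`.
  obtain ⟨q, t, ht, htle⟩ : ∃ q t : ℤ, t = t₀ - a * q ∧ |2 * t + T| ≤ a := by
    refine ⟨(2 * t₀ + T + a) / (2 * a), _, rfl, ?_⟩
    have e1 := Int.emod_nonneg (2 * t₀ + T + a) (b := 2 * a) (by lia)
    have e2 := Int.emod_lt_of_pos (2 * t₀ + T + a) (b := 2 * a) (by lia)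
    rw [Int.emod_def] at e1 e2
    rw [abs_le]
    constructor <;> linarith
  set ρ : ℂ := (ω + t) / a with hρ
  have hρτ : ρ = τ - q := by
    rw [hρ, div_eq_iff haC, ht]
    push_cast
    rw [zsmul_eq_mul] at ht₀
    linear_combination -ht₀
  have hρB : ρ ∈ B := hρτ ▸ B.sub_mem hτ (hint q)
  have hρim : ρ.im = b := by rw [hρτ]; simp [hτb]
  have hbpos : 0 < b := by
    have : (0 : ℝ) < a := by exact_mod_cast ha
    exact pos_of_mul_pos_right (hab ▸ him) this.le
  have hmul : ω * conj ω = n := by rw [Complex.mul_conj, hn]; simp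
  have hadd : ω + conj ω = T := by rw [Complex.add_conj, hre]; push_cast; ring
  have hquad : ω ^ 2 = T * ω - n := by rw [← hmul, ← hadd]; ring
  have hnormρ : Complex.normSq ρ * a ^ 2 = t ^ 2 + T * t + n := by
    have h2 : ((Complex.normSq ρ : ℝ) : ℂ) * a ^ 2 = t ^ 2 + T * t + n := by
      rw [← Complex.mul_conj, hρ, map_div₀, map_add, map_intCast, map_intCast,
        ← hmul, ← hadd]
      field_simp
      ring
    exact_mod_cast h2
  refine ⟨a, t, ha, htle, ?_, ?_, fun z => ⟨fun hz => ?_, ?_⟩⟩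
  · have h2 := hB ρ hρB (fun h => by rw [h] at hρim; simp at hρim; linarith)
    have h3 : (a : ℝ) ^ 2 ≤ t ^ 2 + T * t + n := by
      rw [← hnormρ]
      exact le_mul_of_one_le_left (sq_nonneg _) h2
    exact_mod_cast h3
  -- `ω ρ - (T + t) ρ = -(t ^ 2 + T t + n) / a` is a real element of `B`, hence an integer.
  · have h2 : ω * ρ - (T + t : ℤ) * ρ ∈ B :=
      B.sub_mem (hω ρ hρB) (by simpa using B.zsmul_mem hρB (T + t))
    have h3 : ω * ρ - (T + t : ℤ) * ρ = ((-(t ^ 2 + T * t + n) / a : ℝ) : ℂ) := by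
      rw [hρ]
      push_cast
      field_simp
      linear_combination hquad
    rw [h3] at h2
    obtain ⟨k, hk⟩ := exists_int_of_mem_of_im_eq_zero h1 hB h2 (Complex.ofReal_im _)
    have h4 : -((t : ℝ) ^ 2 + T * t + n) / a = k := by exact_mod_cast hk
    rw [div_eq_iff haR] at h4
    refine ⟨-k, ?_⟩
    have h5 : -(t ^ 2 + T * t + n) = k * a := by exact_mod_cast h4
    linear_combination -h5
  · obtain ⟨l, hl⟩ := (hb z.im).1 ⟨z, hz, rfl⟩
    obtain ⟨k, hk⟩ := exists_int_of_mem_of_im_eq_zero h1 hB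
      (B.sub_mem hz (B.zsmul_mem hρB l)) (by simp [hρim, hl])
    refine ⟨k, l, ?_⟩
    rw [← hk, zsmul_eq_mul]
    ring
  · rintro ⟨k, l, rfl⟩
    exact B.add_mem (hint k) (by simpa using B.zsmul_mem hρB l)

/-- If every reduced form is ambiguous, that is, its middle coefficient is `0` or `±` the first, or its
outer coefficients agree, then `B` is similar to its complex conjugate: `conj B` is `B` in the first
case, and `ρ⁻¹ B` in the second, `ρ` being the second basis vector, which then has length `1`. -/
theorem exists_conj_mem_iff_mul_mem {B : AddSubgroup ℂ} (h1 : (1 : ℂ) ∈ B)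
    (hB : ∀ z ∈ B, z ≠ 0 → 1 ≤ Complex.normSq z) {ω : ℂ} {T n : ℤ} (hre : ω.re = T / 2)
    (him : 0 < ω.im) (hn : Complex.normSq ω = n) (hω : ∀ z ∈ B, ω * z ∈ B)
    (hamb : ∀ a t : ℤ, 0 < a → |2 * t + T| ≤ a → a ^ 2 ≤ t ^ 2 + T * t + n →
      a ∣ t ^ 2 + T * t + n → a ∣ 2 * t + T ∨ t ^ 2 + T * t + n = a ^ 2) :
    ∃ v ∈ B, v ≠ 0 ∧ ∀ z, conj z ∈ B ↔ v * z ∈ B := by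
  obtain ⟨a, t, ha, hle, hsq, hdvd, hmem⟩ := exists_reduced_basis h1 hB hre him hn hω
  have haC : (a : ℂ) ≠ 0 := by exact_mod_cast ha.ne'
  have hmul : ω * conj ω = n := by rw [Complex.mul_conj, hn]; simp
  have hadd : ω + conj ω = T := by rw [Complex.add_conj, hre]; push_cast; ring
  rcases hamb a t ha hle hsq hdvd with ⟨c, hc⟩ | heq
  · refine ⟨1, h1, one_ne_zero, fun z => ?_⟩
    have hconj : ∀ z, z ∈ B → conj z ∈ B := by
      intro z hz
      obtain ⟨k, l, rfl⟩ := (hmem z).1 hz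
      refine (hmem _).2 ⟨k + l * c, -l, ?_⟩
      have hc' : (2 * t + T : ℂ) = a * c := by exact_mod_cast hc
      simp only [map_add, map_mul, map_div₀, map_intCast]
      push_cast
      field_simp
      linear_combination (l : ℂ) * hadd + (l : ℂ) * hc'
    rw [one_mul]
    exact ⟨fun h => by simpa using hconj _ h, hconj z⟩
  · set ρ : ℂ := (ω + t) / a with hρ
    have hρρ : ρ * conj ρ = 1 := by
      have heq' : (t ^ 2 + T * t + n : ℂ) = a ^ 2 := by exact_mod_cast heq
      rw [hρ, map_div₀, map_add, map_intCast, map_intCast]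
      field_simp
      linear_combination hmul + (t : ℂ) * hadd + heq'
    refine ⟨ρ, (hmem ρ).2 ⟨0, 1, by simp⟩, left_ne_zero_of_mul_eq_one hρρ, fun z => ?_⟩
    rw [hmem, hmem]
    constructor
    · rintro ⟨k, l, h⟩
      have hz : z = k + l * conj ρ := by
        rw [← Complex.conj_conj z, h]
        simp
      refine ⟨l, k, ?_⟩
      rw [hz]
      linear_combination (l : ℂ) * hρρ
    · rintro ⟨k, l, h⟩
      refine ⟨l, k, ?_⟩
      have h2 := congrArg conj h
      simp only [map_mul, map_add, map_intCast] at h2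
      linear_combination ρ * h2 + ((l : ℂ) - conj z) * hρρ

end Reduction

/-! ### Arithmetic of imaginary quadratic fields -/

section QuadraticField

open ComplexConjugate

theorem sqrt_mul_I_sq (d : ℕ) : (((Real.sqrt d : ℝ) : ℂ) * Complex.I) ^ 2 = -d := by
  have h : ((Real.sqrt d : ℝ) : ℂ) ^ 2 = d := by
    rw [← Complex.ofReal_pow, Real.sq_sqrt (Nat.cast_nonneg d)]
    simp
  rw [mul_pow, h, Complex.I_sq]
  ring

theorem exists_rat_coords {d : ℕ} (z : imagQuadField d) :
    ∃ x y : ℚ, (z : ℂ) = x + y * (((Real.sqrt d : ℝ) : ℂ) * Complex.I) := by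
  have hs := sqrt_mul_I_sq d
  have halg : IsAlgebraic ℚ (((Real.sqrt d : ℝ) : ℂ) * Complex.I) :=
    (isAlgebraic_iff (S := imagQuadField d)
      (x := ⟨_, mem_adjoin_simple_self ℚ _⟩)).1 (Algebra.IsAlgebraic.isAlgebraic _)
  have hz : (z : ℂ) ∈ (imagQuadField d).toSubalgebra := z.2
  rw [adjoin_simple_toSubalgebra_of_isAlgebraic halg] at hz
  generalize (z : ℂ) = z at hz
  induction hz using Algebra.adjoin_induction with
  | mem z hz => exact ⟨0, 1, by rw [Set.mem_singleton_iff.1 hz]; simp⟩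
  | algebraMap r => exact ⟨r, 0, by simp⟩
  | add z w _ _ h1 h2 =>
    obtain ⟨x, y, rfl⟩ := h1
    obtain ⟨x', y', rfl⟩ := h2
    exact ⟨x + x', y + y', by push_cast; ring⟩
  | mul z w _ _ h1 h2 =>
    obtain ⟨x, y, rfl⟩ := h1
    obtain ⟨x', y', rfl⟩ := h2
    refine ⟨x * x' - d * (y * y'), x * y' + y * x', ?_⟩
    push_cast
    linear_combination (y * y' : ℂ) * hs

theorem ratCast_add_mul_mem (d : ℕ) (x y : ℚ) :
    (x + y * (((Real.sqrt d : ℝ) : ℂ) * Complex.I) : ℂ) ∈ imagQuadField d :=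
  add_mem (by simp)
    (mul_mem (by simp) (mem_adjoin_simple_self ℚ _))

theorem conj_mem_imagQuadField {d : ℕ} (z : imagQuadField d) :
    conj (z : ℂ) ∈ imagQuadField d := by
  obtain ⟨x, y, h⟩ := exists_rat_coords z
  have h2 : conj (z : ℂ) = x + (-y : ℚ) * (((Real.sqrt d : ℝ) : ℂ) * Complex.I) := by
    rw [h]
    simp [Complex.conj_ofReal]
  exact h2 ▸ ratCast_add_mul_mem d x (-y)

/-- Complex conjugation as an automorphism of `ℚ(√-d)`. -/
noncomputable def conjField (d : ℕ) : imagQuadField d ≃+* imagQuadField d where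
  toFun z := ⟨conj (z : ℂ), conj_mem_imagQuadField z⟩
  invFun z := ⟨conj (z : ℂ), conj_mem_imagQuadField z⟩
  left_inv _ := Subtype.ext (Complex.conj_conj _)
  right_inv _ := Subtype.ext (Complex.conj_conj _)
  map_mul' _ _ := Subtype.ext (map_mul conj _ _)
  map_add' _ _ := Subtype.ext (map_add conj _ _)

theorem coe_conjField {d : ℕ} (z : imagQuadField d) : (conjField d z : ℂ) = conj (z : ℂ) := rfl

theorem conjField_conjField {d : ℕ} (z : imagQuadField d) : conjField d (conjField d z) = z :=
  (conjField d).left_inv z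

theorem coe_mul_conjField {d : ℕ} (z : imagQuadField d) :
    ((z * conjField d z : imagQuadField d) : ℂ) = (Complex.normSq z : ℝ) := by
  rw [← Complex.mul_conj, ← coe_conjField]
  rfl

theorem normSq_ratCast_add_mul (d : ℕ) (x y : ℚ) :
    Complex.normSq (x + y * (((Real.sqrt d : ℝ) : ℂ) * Complex.I)) = x ^ 2 + d * y ^ 2 := by
  have hs := Real.sq_sqrt (Nat.cast_nonneg (α := ℝ) d)
  have h : (x + y * (((Real.sqrt d : ℝ) : ℂ) * Complex.I) : ℂ) = ⟨x, y * Real.sqrt d⟩ := by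
    apply Complex.ext <;> simp
  rw [h, Complex.normSq_mk]
  linear_combination (y : ℝ) ^ 2 * hs

theorem exists_int_of_isIntegral_of_ratCast {z : ℂ} (hz : IsIntegral ℤ z) {q : ℚ} (h : z = q) :
    ∃ n : ℤ, q = n := by
  have h1 : IsIntegral ℤ (algebraMap ℚ ℂ q) := by simpa [← h] using hz
  have h2 : IsIntegral ℤ q :=
    (isIntegral_algebraMap_iff (algebraMap ℚ ℂ).injective).1 h1
  obtain ⟨n, hn⟩ := IsIntegrallyClosed.isIntegral_iff.1 h2
  exact ⟨n, by simpa using hn.symm⟩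

theorem isIntegral_coe {d : ℕ} (r : 𝓞 (imagQuadField d)) :
    IsIntegral ℤ ((r : imagQuadField d) : ℂ) :=
  r.isIntegral_coe.map (IsScalarTower.toAlgHom ℤ (imagQuadField d) ℂ)

theorem exists_nat_normSq_eq {d : ℕ} (r : 𝓞 (imagQuadField d)) :
    ∃ n : ℕ, Complex.normSq ((r : imagQuadField d) : ℂ) = n := by
  obtain ⟨x, y, h⟩ := exists_rat_coords (r : imagQuadField d)
  have h1 : IsIntegral ℤ ((Complex.normSq ((r : imagQuadField d) : ℂ) : ℝ) : ℂ) := by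
    rw [← Complex.mul_conj]
    exact (isIntegral_coe r).mul ((isIntegral_coe r).map
      ((Complex.conjAe : ℂ →ₐ[ℝ] ℂ).restrictScalars ℤ))
  have h2 : Complex.normSq ((r : imagQuadField d) : ℂ) = ((x ^ 2 + d * y ^ 2 : ℚ) : ℝ) := by
    rw [h, normSq_ratCast_add_mul]
    push_cast
    rfl
  obtain ⟨n, hn⟩ := exists_int_of_isIntegral_of_ratCast h1 (q := x ^ 2 + d * y ^ 2)
    (by rw [h2]; simp)
  have hn0 : 0 ≤ n := by
    have : (0 : ℚ) ≤ n := hn ▸ by positivity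
    exact_mod_cast this
  obtain ⟨k, rfl⟩ := Int.eq_ofNat_of_zero_le hn0
  exact ⟨k, by rw [h2, hn]; simp⟩

/-- The norm of `u`, if it is a unit of the ring of integers, is a positive rational number that is
integral together with its inverse. -/
theorem mul_conjField_eq_one_of_unit {d : ℕ} (u : imagQuadField d) (hu : u ≠ 0)
    (h1 : u * conjField d u ∈ (algebraMap (𝓞 (imagQuadField d)) (imagQuadField d)).range)
    (h2 : (u * conjField d u)⁻¹ ∈ (algebraMap (𝓞 (imagQuadField d)) (imagQuadField d)).range) :
    u * conjField d u = 1 := by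
  obtain ⟨r, hr⟩ := h1
  obtain ⟨r', hr'⟩ := h2
  have hval : ∀ z : imagQuadField d, Complex.normSq ((z * conjField d z : imagQuadField d) : ℂ) =
      Complex.normSq z ^ 2 := fun z => by
    rw [coe_mul_conjField, Complex.normSq_ofReal, sq]
  obtain ⟨n, hn⟩ := exists_nat_normSq_eq r
  obtain ⟨n', hn'⟩ := exists_nat_normSq_eq r'
  have e1 : Complex.normSq (u : ℂ) ^ 2 = n := by rw [← hn, ← hval, ← hr]
  have e2 : (Complex.normSq (u : ℂ) ^ 2)⁻¹ = n' := by
    rw [← hn', ← hval, ← Complex.normSq_inv]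
    congr 1
    have := congrArg (algebraMap (imagQuadField d) ℂ) hr'
    rw [map_inv₀] at this
    exact this.symm
  have hpos : 0 < Complex.normSq (u : ℂ) := Complex.normSq_pos.2 (by simpa using hu)
  have e3 : n * n' = 1 := by
    have : (n * n' : ℝ) = 1 := by rw [← e1, ← e2, mul_inv_cancel₀ (by positivity)]
    exact_mod_cast this
  have e4 : Complex.normSq (u : ℂ) = 1 := by
    rw [Nat.eq_one_of_mul_eq_one_right e3, Nat.cast_one] at e1
    nlinarith
  apply Subtype.ext
  rw [coe_mul_conjField, e4]
  simp

theorem eq_one_of_squarefree_of_mul_sq_eq_sq {d : ℕ} (hsq : Squarefree d) {a b : ℕ} (hb : b ≠ 0)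
    (h : d * b ^ 2 = a ^ 2) : d = 1 := by
  obtain ⟨c, rfl⟩ : b ∣ a := (Nat.pow_dvd_pow_iff two_ne_zero).1 (Dvd.intro_left _ h)
  have h2 : d = c * c := by
    have hb2 : 0 < b ^ 2 := by positivity
    apply Nat.eq_of_mul_eq_mul_right hb2
    rw [h]; ring
  have := Nat.isUnit_iff.1 (hsq c ⟨1, by rw [h2]; ring⟩)
  rw [h2, this]

theorem eq_three_of_squarefree_of_mul_sq_eq {d : ℕ} (hsq : Squarefree d) {a b : ℕ} (hb : b ≠ 0)
    (h : d * b ^ 2 = 3 * a ^ 2) : d = 3 := by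
  by_cases h3 : 3 ∣ d
  · obtain ⟨e, rfl⟩ := h3
    have := eq_one_of_squarefree_of_mul_sq_eq_sq (hsq.of_mul_right) hb (a := a) (by lia)
    lia
  · have hb3 : 3 ∣ b := Nat.prime_three.dvd_of_dvd_pow
      ((Nat.prime_three.dvd_mul.1 ⟨_, h⟩).resolve_left h3)
    obtain ⟨c, rfl⟩ := hb3
    have hsq3 : Squarefree (3 * d) := (Nat.squarefree_mul
      ((Nat.Prime.coprime_iff_not_dvd Nat.prime_three).2 h3)).2
        ⟨Nat.prime_three.prime.irreducible.squarefree, hsq⟩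
    have := eq_one_of_squarefree_of_mul_sq_eq_sq hsq3 (a := a) (b := c) (by lia) (by lia)
    lia

/-- For `z = x + y √-d` the trace `2 x` is an integer of absolute value at most `2`, and the values `0`
and `±1` force `d = 1` and `d = 3`. -/
theorem eq_one_or_neg_one_of_mul_conjField {d : ℕ} (hd : 0 < d) (hsq : Squarefree d)
    (hd1 : d ≠ 1) (hd3 : d ≠ 3) (z : imagQuadField d)
    (hz : z ∈ (algebraMap (𝓞 (imagQuadField d)) (imagQuadField d)).range)
    (h1 : z * conjField d z = 1) : z = 1 ∨ z = -1 := by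
  obtain ⟨r, rfl⟩ := hz
  obtain ⟨x, y, h⟩ := exists_rat_coords (r : imagQuadField d)
  obtain ⟨k, hk⟩ := exists_int_of_isIntegral_of_ratCast (q := 2 * x) ((isIntegral_coe r).add
    ((isIntegral_coe r).map ((Complex.conjAe : ℂ →ₐ[ℝ] ℂ).restrictScalars ℤ))) (by
      show ((r : imagQuadField d) : ℂ) + conj ((r : imagQuadField d) : ℂ) = _
      rw [h]
      simp [Complex.conj_ofReal]
      ring)
  have hN : x ^ 2 + d * y ^ 2 = 1 := by
    have h2 := congrArg (fun w : imagQuadField d => (w : ℂ)) h1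
    simp only [coe_mul_conjField] at h2
    rw [h, normSq_ratCast_add_mul] at h2
    have h3 : (x : ℝ) ^ 2 + d * y ^ 2 = 1 := Complex.ofReal_injective (by rw [h2]; simp)
    exact_mod_cast h3
  have hdQ : (0 : ℚ) < d := by exact_mod_cast hd
  have hk4 : k ^ 2 ≤ 4 := by
    have : (k : ℚ) ^ 2 ≤ 4 := by
      rw [← hk]
      nlinarith [mul_nonneg hdQ.le (sq_nonneg y)]
    exact_mod_cast this
  have hx : x = k / 2 := by linarith
  have hyden : (y.den : ℚ) ≠ 0 := by exact_mod_cast y.den_ne_zero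
  have hy : y ^ 2 * (y.den : ℚ) ^ 2 = (y.num.natAbs : ℚ) ^ 2 := by
    rw [← mul_pow, Rat.mul_den_eq_num, Nat.cast_natAbs, Int.cast_abs, sq_abs]
  have hne : d * y ^ 2 ≠ 0 → y.num.natAbs ≠ 0 := fun h0 h2 => h0 (by
    rw [Int.natAbs_eq_zero, Rat.num_eq_zero] at h2
    simp [h2])
  have hkle : -2 ≤ k ∧ k ≤ 2 := ⟨by nlinarith, by nlinarith⟩
  obtain ⟨hk1, hk2⟩ := hkle
  have hodd : x ^ 2 = 1 / 4 → d = 3 := fun hx2 => by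
    have h3 : d * y ^ 2 = 3 / 4 := by linarith
    refine eq_three_of_squarefree_of_mul_sq_eq hsq (a := y.den) (b := 2 * y.num.natAbs)
      (mul_ne_zero two_ne_zero (hne (by rw [h3]; norm_num))) ?_
    have : (d : ℚ) * (2 * (y.num.natAbs : ℚ)) ^ 2 = 3 * (y.den : ℚ) ^ 2 := by
      rw [mul_pow, ← hy]
      linear_combination 4 * (y.den : ℚ) ^ 2 * h3
    exact_mod_cast this
  have hpm : x ^ 2 = 1 → y = 0 := fun hx2 => by
    have h3 : d * y ^ 2 = 0 := by linarith
    simpa [hd.ne'] using h3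
  interval_cases k
  · right
    apply Subtype.ext
    rw [h, hpm (by rw [hx]; norm_num), hx]
    norm_num
  · exact absurd (hodd (by rw [hx]; norm_num)) hd3
  · refine absurd (eq_one_of_squarefree_of_mul_sq_eq_sq hsq (a := y.den) (b := y.num.natAbs)
      (hne ?_) ?_) hd1
    · intro h3
      rw [h3, hx] at hN
      norm_num at hN
    · have h3 : d * y ^ 2 = 1 := by rw [hx] at hN; linarith
      have : (d : ℚ) * (y.num.natAbs : ℚ) ^ 2 = (y.den : ℚ) ^ 2 := by
        rw [← hy]
        linear_combination (y.den : ℚ) ^ 2 * h3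
      exact_mod_cast this
  · exact absurd (hodd (by rw [hx]; norm_num)) hd3
  · left
    apply Subtype.ext
    rw [h, hpm (by rw [hx]; norm_num), hx]
    norm_num

theorem isIntegral_of_sq_eq {A : Type*} [CommRing A] {z : A} {T n : ℤ}
    (h : z ^ 2 = T * z - n) : IsIntegral ℤ z := by
  refine ⟨Polynomial.X ^ 2 - Polynomial.C T * Polynomial.X + Polynomial.C n, by monicity!, ?_⟩
  rw [Polynomial.eval₂_add, Polynomial.eval₂_sub, Polynomial.eval₂_mul, Polynomial.eval₂_X_pow,
    Polynomial.eval₂_C, Polynomial.eval₂_C, Polynomial.eval₂_X, h]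
  simp

theorem exists_ringOfIntegers_of_sq_eq {d : ℕ} {x y : ℚ} {T n : ℤ}
    (h : (x + y * (((Real.sqrt d : ℝ) : ℂ) * Complex.I)) ^ 2 =
      T * (x + y * (((Real.sqrt d : ℝ) : ℂ) * Complex.I)) - n) :
    ∃ ω : 𝓞 (imagQuadField d),
      ((ω : imagQuadField d) : ℂ) = x + y * (((Real.sqrt d : ℝ) : ℂ) * Complex.I) :=
  ⟨⟨⟨_, ratCast_add_mul_mem d x y⟩, isIntegral_of_sq_eq (T := T) (n := n) (Subtype.ext (by
    push_cast
    exact h))⟩, rfl⟩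

/-- An integer `ω` of `ℚ(√-d)` with `ω ^ 2 = T ω - n`, namely `(1 + √-d) / 2` if `d ≡ 3 mod 4` and
`√-d` otherwise; the discriminant of the field is `T ^ 2 - 4 n`. -/
theorem exists_integral_generator (d : ℕ) (hd : 0 < d) :
    ∃ (ω : 𝓞 (imagQuadField d)) (T n : ℤ), ((ω : imagQuadField d) : ℂ).re = T / 2 ∧
      0 < ((ω : imagQuadField d) : ℂ).im ∧ Complex.normSq ((ω : imagQuadField d) : ℂ) = n ∧
      (d % 4 = 3 ∧ T = 1 ∧ 4 * n = d + 1 ∨ d % 4 ≠ 3 ∧ T = 0 ∧ n = d) := by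
  have hs := sqrt_mul_I_sq d
  have hpos : 0 < Real.sqrt d := Real.sqrt_pos.2 (by exact_mod_cast hd)
  by_cases h : d % 4 = 3
  · obtain ⟨n, hn⟩ : ∃ n : ℤ, 4 * n = d + 1 := ⟨(d + 1) / 4, by lia⟩
    have hnC : (4 * n : ℂ) = d + 1 := by exact_mod_cast hn
    have hnR : (4 * n : ℝ) = d + 1 := by exact_mod_cast hn
    obtain ⟨ω, hω⟩ := exists_ringOfIntegers_of_sq_eq (d := d) (x := 1 / 2) (y := 1 / 2) (T := 1)
      (n := n) (by push_cast; linear_combination hs / 4 + hnC / 4)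
    refine ⟨ω, 1, n, ?_, ?_, ?_, Or.inl ⟨h, rfl, hn⟩⟩
    · rw [hω]; simp
    · rw [hω]; simpa using hpos
    · rw [hω, normSq_ratCast_add_mul]
      push_cast
      linarith
  · obtain ⟨ω, hω⟩ := exists_ringOfIntegers_of_sq_eq (d := d) (x := 0) (y := 1) (T := 0)
      (n := d) (by push_cast; linear_combination hs)
    refine ⟨ω, 0, d, ?_, ?_, ?_, Or.inr ⟨h, rfl, rfl⟩⟩
    · rw [hω]; simp
    · rw [hω]; simpa using hpos
    · rw [hω, normSq_ratCast_add_mul]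
      push_cast
      ring

end QuadraticField

/-! ### Conjugation and ideal classes -/

section ClassGroup

open ComplexConjugate IsDedekindDomain FractionalIdeal

/-- Complex conjugation on the ring of integers of `ℚ(√-d)`. -/
noncomputable def conjInt (d : ℕ) : 𝓞 (imagQuadField d) ≃+* 𝓞 (imagQuadField d) :=
  RingOfIntegers.mapRingEquiv (conjField d)

theorem algebraMap_conjInt {d : ℕ} (r : 𝓞 (imagQuadField d)) :
    algebraMap (𝓞 (imagQuadField d)) (imagQuadField d) (conjInt d r) =
      conjField d (algebraMap (𝓞 (imagQuadField d)) (imagQuadField d) r) := rfl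

theorem conjInt_conjInt {d : ℕ} (r : 𝓞 (imagQuadField d)) : conjInt d (conjInt d r) = r :=
  RingOfIntegers.ext (conjField_conjField _)

/-- For an ideal `I` and an element `α` of the ring of integers, the group of complex numbers `z`
with `z α ∈ I`, that is, the lattice `α⁻¹ I ⊆ ℂ` when `α ≠ 0`. -/
def scaledLattice {d : ℕ} (I : Ideal (𝓞 (imagQuadField d))) (α : 𝓞 (imagQuadField d)) :
    AddSubgroup ℂ where
  carrier := {z | ∃ r ∈ I, ((r : imagQuadField d) : ℂ) = z * ((α : imagQuadField d) : ℂ)}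
  zero_mem' := ⟨0, I.zero_mem, by simp⟩
  add_mem' := by
    rintro z w ⟨r, hr, h1⟩ ⟨s, hs, h2⟩
    exact ⟨r + s, I.add_mem hr hs, by rw [add_mul, ← h1, ← h2]; simp⟩
  neg_mem' := by
    rintro z ⟨r, hr, h1⟩
    exact ⟨-r, I.neg_mem hr, by rw [neg_mul, ← h1]; simp⟩

theorem mem_scaledLattice {d : ℕ} {I : Ideal (𝓞 (imagQuadField d))} {α : 𝓞 (imagQuadField d)}
    {z : ℂ} : z ∈ scaledLattice I α ↔
      ∃ r ∈ I, ((r : imagQuadField d) : ℂ) = z * ((α : imagQuadField d) : ℂ) := Iff.rfl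

theorem coe_ringOfIntegers_ne_zero {d : ℕ} {r : 𝓞 (imagQuadField d)} (hr : r ≠ 0) :
    ((r : imagQuadField d) : ℂ) ≠ 0 := by
  simpa using hr

/-- For an element `α` of least norm in `I`, the shortest nonzero vector of `α⁻¹ I` is `1`. -/
theorem exists_minimal_scaledLattice {d : ℕ} {I : Ideal (𝓞 (imagQuadField d))} (hI : I ≠ ⊥) :
    ∃ α ∈ I, α ≠ 0 ∧ 1 ∈ scaledLattice I α ∧
      (∀ z ∈ scaledLattice I α, z ≠ 0 → 1 ≤ Complex.normSq z) ∧
      ∀ ω : 𝓞 (imagQuadField d), ∀ z ∈ scaledLattice I α,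
        ((ω : imagQuadField d) : ℂ) * z ∈ scaledLattice I α := by
  classical
  obtain ⟨β, hβ, hβ0⟩ := Submodule.exists_mem_ne_zero_of_ne_bot hI
  have hex : ∃ n : ℕ, ∃ r ∈ I, r ≠ 0 ∧ Complex.normSq ((r : imagQuadField d) : ℂ) = n := by
    obtain ⟨n, hn⟩ := exists_nat_normSq_eq β
    exact ⟨n, β, hβ, hβ0, hn⟩
  obtain ⟨α, hα, hα0, hαn⟩ := Nat.find_spec hex
  have hαC := coe_ringOfIntegers_ne_zero hα0
  refine ⟨α, hα, hα0, ⟨α, hα, by simp⟩, ?_, ?_⟩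
  · rintro z ⟨r, hr, hrz⟩ hz
    have hr0 : r ≠ 0 := by
      rintro rfl
      exact mul_ne_zero hz hαC (by simpa using hrz.symm)
    obtain ⟨n, hn⟩ := exists_nat_normSq_eq r
    have hle : Nat.find hex ≤ n := Nat.find_min' hex ⟨r, hr, hr0, hn⟩
    have h1 : Complex.normSq ((α : imagQuadField d) : ℂ) ≤
        Complex.normSq ((r : imagQuadField d) : ℂ) := by
      rw [hn, hαn]
      exact_mod_cast hle
    rw [hrz, Complex.normSq_mul] at h1
    exact (le_mul_iff_one_le_left (Complex.normSq_pos.2 hαC)).1 h1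
  · rintro ω z ⟨r, hr, hrz⟩
    exact ⟨ω * r, I.mul_mem_left ω hr, by rw [mul_assoc, ← hrz]; simp⟩

/-- If all reduced forms are ambiguous, a prime is equivalent to its complex conjugate. -/
theorem exists_spanSingleton_mul_eq_comapPrime {d : ℕ} (P : HeightOneSpectrum (𝓞 (imagQuadField d)))
    {ω : 𝓞 (imagQuadField d)} {T n : ℤ} (hre : ((ω : imagQuadField d) : ℂ).re = T / 2)
    (him : 0 < ((ω : imagQuadField d) : ℂ).im)
    (hn : Complex.normSq ((ω : imagQuadField d) : ℂ) = n)
    (hamb : ∀ a t : ℤ, 0 < a → |2 * t + T| ≤ a → a ^ 2 ≤ t ^ 2 + T * t + n →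
      a ∣ t ^ 2 + T * t + n → a ∣ 2 * t + T ∨ t ^ 2 + T * t + n = a ^ 2) :
    ∃ u : imagQuadField d, u ≠ 0 ∧
      spanSingleton (𝓞 (imagQuadField d))⁰ u *
        (P.asIdeal : FractionalIdeal (𝓞 (imagQuadField d))⁰ (imagQuadField d)) =
        (comapPrime (conjInt d) P).asIdeal := by
  obtain ⟨α, hα, hα0, h1, hmin, hmul⟩ := exists_minimal_scaledLattice P.ne_bot
  obtain ⟨v, ⟨s, hs, hsv⟩, hv0, hv⟩ := exists_conj_mem_iff_mul_mem h1 hmin hre him hn (hmul ω) hamb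
  have hαC := coe_ringOfIntegers_ne_zero hα0
  have hsC : ((s : imagQuadField d) : ℂ) ≠ 0 := hsv ▸ mul_ne_zero hv0 hαC
  have hcα : conj ((α : imagQuadField d) : ℂ) ≠ 0 := by simpa using hα0
  refine ⟨conjField d α / s, div_ne_zero (fun h => hcα (by rw [← coe_conjField, h]; simp))
    (fun h => hsC (by rw [h]; simp)), ?_⟩
  -- Applied to `z / conj α`, the similarity of `α⁻¹ P` to its conjugate becomes one of `P`.
  have key : ∀ z : ℂ, (∃ r ∈ P.asIdeal, ((r : imagQuadField d) : ℂ) = conj z) ↔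
      ∃ r ∈ P.asIdeal, ((r : imagQuadField d) : ℂ) =
        z * ((s : imagQuadField d) : ℂ) / conj ((α : imagQuadField d) : ℂ) := by
    intro z
    have h2 := hv (z / conj ((α : imagQuadField d) : ℂ))
    rw [mem_scaledLattice, mem_scaledLattice, map_div₀, Complex.conj_conj,
      div_mul_cancel₀ _ hαC] at h2
    rw [h2, hsv]
    have : v * (z / conj ((α : imagQuadField d) : ℂ)) * ((α : imagQuadField d) : ℂ) =
      z * (v * ((α : imagQuadField d) : ℂ)) / conj ((α : imagQuadField d) : ℂ) := by ring
    rw [this]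
  ext z
  rw [mem_singleton_mul, mem_coeIdeal]
  have hconj : (∃ r ∈ P.asIdeal, ((r : imagQuadField d) : ℂ) = conj (z : ℂ)) ↔
      ∃ r ∈ (comapPrime (conjInt d) P).asIdeal, algebraMap _ (imagQuadField d) r = z := by
    constructor
    · rintro ⟨r, hr, h⟩
      refine ⟨conjInt d r, ?_, ?_⟩
      · rw [mem_comapPrime, conjInt_conjInt]
        exact hr
      · rw [algebraMap_conjInt]
        exact Subtype.ext (by rw [coe_conjField, h, Complex.conj_conj])
    · rintro ⟨r, hr, rfl⟩
      exact ⟨conjInt d r, hr, rfl⟩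
  have hquot : (∃ r ∈ P.asIdeal, ((r : imagQuadField d) : ℂ) =
        z * ((s : imagQuadField d) : ℂ) / conj ((α : imagQuadField d) : ℂ)) ↔
      ∃ y ∈ (P.asIdeal : FractionalIdeal (𝓞 (imagQuadField d))⁰ (imagQuadField d)),
        z = conjField d α / s * y := by
    constructor
    · rintro ⟨r, hr, h⟩
      refine ⟨r, mem_coeIdeal_of_mem _ hr, Subtype.ext ?_⟩
      push_cast
      rw [h, coe_conjField]
      field_simp
    · rintro ⟨y, hy, rfl⟩
      obtain ⟨r, hr, rfl⟩ := (mem_coeIdeal _).1 hy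
      refine ⟨r, hr, ?_⟩
      push_cast
      rw [coe_conjField]
      field_simp
  rw [← hconj, ← hquot, key]

/-- The bound on the discriminant forces `a = 1` in the reduced basis, so that `α⁻¹ I` consists of
integers. This covers `d = 1` and `d = 3`. -/
theorem isPrincipalIdealRing_of_discr_le_four {d : ℕ} {ω : 𝓞 (imagQuadField d)} {T n : ℤ}
    (hre : ((ω : imagQuadField d) : ℂ).re = T / 2)
    (him : 0 < ((ω : imagQuadField d) : ℂ).im)
    (hn : Complex.normSq ((ω : imagQuadField d) : ℂ) = n) (hD : 4 * n - T ^ 2 ≤ 4) :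
    IsPrincipalIdealRing (𝓞 (imagQuadField d)) := by
  refine ⟨fun I => ?_⟩
  by_cases hI : I = ⊥
  · exact hI ▸ bot_isPrincipal
  obtain ⟨α, hα, hα0, h1, hmin, hmul⟩ := exists_minimal_scaledLattice hI
  obtain ⟨a, t, ha, hle, hsq, -, hmem⟩ := exists_reduced_basis h1 hmin hre him hn (hmul ω)
  have hαC := coe_ringOfIntegers_ne_zero hα0
  obtain rfl : a = 1 := by
    have h2 : (2 * t + T) ^ 2 ≤ a ^ 2 := sq_le_sq' (by linarith [(abs_le.1 hle).1])
      (abs_le.1 hle).2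
    nlinarith
  refine ⟨α, le_antisymm (fun r hr => ?_) ((Ideal.span_singleton_le_iff_mem I).2 hα)⟩
  obtain ⟨k, l, hkl⟩ := (hmem (((r : imagQuadField d) : ℂ) / ((α : imagQuadField d) : ℂ))).1
    ⟨r, hr, (div_mul_cancel₀ _ hαC).symm⟩
  refine Ideal.mem_span_singleton'.2 ⟨k + l * (ω + t), RingOfIntegers.ext (Subtype.ext ?_)⟩
  rw [div_eq_iff hαC] at hkl
  rw [hkl]
  simp

/-- Conjugation permutes the two ideal classes and fixes the principal one, so it fixes both. -/
theorem conj_class_of_classNumber_eq_two {d : ℕ} (h : classNumber (imagQuadField d) = 2)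
    (P : HeightOneSpectrum (𝓞 (imagQuadField d))) :
    ∃ u : imagQuadField d, u ≠ 0 ∧
      spanSingleton (𝓞 (imagQuadField d))⁰ u *
        (P.asIdeal : FractionalIdeal (𝓞 (imagQuadField d))⁰ (imagQuadField d)) =
        (comapPrime (conjInt d) P).asIdeal := by
  let Q := comapPrime (conjInt d) P
  have hP := mem_nonZeroDivisors_of_ne_zero P.ne_bot
  have hQ := mem_nonZeroDivisors_of_ne_zero Q.ne_bot
  have hPQ : P.asIdeal.IsPrincipal ↔ Q.asIdeal.IsPrincipal := by
    have aux : ∀ I : Ideal (𝓞 (imagQuadField d)), I.IsPrincipal →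
        (I.comap (conjInt d : 𝓞 (imagQuadField d) →+* 𝓞 (imagQuadField d))).IsPrincipal := by
      rintro I ⟨g, rfl⟩
      refine ⟨conjInt d g, ?_⟩
      ext r
      rw [Ideal.mem_comap, ← Ideal.span, ← Ideal.span, Ideal.mem_span_singleton',
        Ideal.mem_span_singleton']
      constructor
      · rintro ⟨c, hc⟩
        refine ⟨conjInt d c, ?_⟩
        rw [← map_mul, hc]
        exact conjInt_conjInt r
      · rintro ⟨c, rfl⟩
        refine ⟨conjInt d c, ?_⟩
        simp [conjInt_conjInt]
    refine ⟨aux _, fun hpr => ?_⟩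
    have h2 := aux _ hpr
    have h3 : Q.asIdeal.comap (conjInt d : 𝓞 (imagQuadField d) →+* 𝓞 (imagQuadField d)) =
        P.asIdeal := by
      ext r
      rw [Ideal.mem_comap]
      show conjInt d (conjInt d r) ∈ P.asIdeal ↔ _
      rw [conjInt_conjInt]
    rwa [h3] at h2
  have hmk : ClassGroup.mk0 ⟨P.asIdeal, hP⟩ = ClassGroup.mk0 ⟨Q.asIdeal, hQ⟩ := by
    by_cases hp : P.asIdeal.IsPrincipal
    · rw [(ClassGroup.mk0_eq_one_iff hP).2 hp, (ClassGroup.mk0_eq_one_iff hQ).2 (hPQ.1 hp)]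
    · have h2 : Nat.card (ClassGroup (𝓞 (imagQuadField d))) = 2 := by
        rw [Nat.card_eq_fintype_card]
        exact h
      exact ((Nat.card_eq_two_iff' 1).1 h2).unique
        (fun h3 => hp ((ClassGroup.mk0_eq_one_iff hP).1 h3))
        (fun h3 => hp (hPQ.2 ((ClassGroup.mk0_eq_one_iff hQ).1 h3)))
  obtain ⟨x, hx, h2⟩ :=
    (ClassGroup.mk0_eq_mk0_iff_exists_fraction_ring (K := imagQuadField d)).1 hmk
  exact ⟨x, hx, h2⟩

/-- For the listed `d`, all reduced forms of the discriminant of `ℚ(√-d)` are ambiguous. Reduced forms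
satisfy `3 a ^ 2 ≤ 4 n - T ^ 2 ≤ 427`, which leaves finitely many to check. -/
theorem reduced_forms_ambiguous {d : ℕ}
    (h : d ∈ ({5, 6, 10, 13, 15, 22, 35, 37, 51, 58, 91, 115, 123, 187, 235, 267, 403, 427} :
      Finset ℕ)) {T n : ℤ}
    (hTn : d % 4 = 3 ∧ T = 1 ∧ 4 * n = d + 1 ∨ d % 4 ≠ 3 ∧ T = 0 ∧ n = d)
    (a t : ℤ) (ha : 0 < a) (hle : |2 * t + T| ≤ a) (hsq : a ^ 2 ≤ t ^ 2 + T * t + n)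
    (hdvd : a ∣ t ^ 2 + T * t + n) : a ∣ 2 * t + T ∨ t ^ 2 + T * t + n = a ^ 2 := by
  -- `T ∈ {0, 1}`, `a ≤ 12` and `|2 t + T| ≤ a` give `-7 ≤ t ≤ 6`; write `t = j - 7`.
  have key : ∀ d ∈ ({5, 6, 10, 13, 15, 22, 35, 37, 51, 58, 91, 115, 123, 187, 235, 267, 403,
      427} : Finset ℕ), ∀ a : Fin 13, ∀ j : Fin 14,
      let T : ℤ := if d % 4 = 3 then 1 else 0
      let n : ℤ := if d % 4 = 3 then (d + 1) / 4 else d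
      let t : ℤ := j - 7
      0 < (a : ℤ) → |2 * t + T| ≤ a → (a : ℤ) ^ 2 ≤ t ^ 2 + T * t + n →
        (a : ℤ) ∣ t ^ 2 + T * t + n → (a : ℤ) ∣ 2 * t + T ∨ t ^ 2 + T * t + n = (a : ℤ) ^ 2 := by
    decide +kernel
  have hT : T = if d % 4 = 3 then 1 else 0 := by
    rcases hTn with ⟨h1, h2, -⟩ | ⟨h1, h2, -⟩ <;> simp [h1, h2]
  have hn : n = if d % 4 = 3 then ((d : ℤ) + 1) / 4 else d := by
    rcases hTn with ⟨h1, -, h2⟩ | ⟨h1, -, h2⟩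
    · rw [if_pos h1]; lia
    · rw [if_neg h1, h2]
  have hD : 4 * n ≤ 428 := by
    have : ∀ d ∈ ({5, 6, 10, 13, 15, 22, 35, 37, 51, 58, 91, 115, 123, 187, 235, 267, 403,
      427} : Finset ℕ), (d % 4 = 3 → d ≤ 427) ∧ (d % 4 ≠ 3 → d ≤ 58) := by decide
    have := this d h
    lia
  obtain ⟨hl, hr⟩ := abs_le.1 hle
  have ha12 : a ≤ 12 := by
    have h2 : (2 * t + T) ^ 2 ≤ a ^ 2 := sq_le_sq' hl hr
    nlinarith [sq_nonneg T]
  have hT01 : 0 ≤ T ∧ T ≤ 1 := by rw [hT]; split_ifs <;> norm_num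
  have := key d h ⟨a.toNat, by lia⟩ ⟨(t + 7).toNat, by lia⟩
  have e1 : ((a.toNat : ℕ) : ℤ) = a := Int.toNat_of_nonneg ha.le
  have e2 : (((t + 7).toNat : ℕ) : ℤ) - 7 = t := by lia
  simp only [e1, e2, ← hT, ← hn] at this
  exact this ha hle hsq hdvd

end ClassGroup

/-! ### Spherical designs on the circle -/

open scoped Pointwise in
theorem integral_toSphere_comp_linearIsometryEquiv {E F : Type*} [NormedAddCommGroup E]
    [InnerProductSpace ℝ E] [FiniteDimensional ℝ E] [MeasurableSpace E] [BorelSpace E]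
    [NormedAddCommGroup F] [NormedSpace ℝ F] (e : E ≃ₗᵢ[ℝ] E) (f : E → F) :
    ∫ u : Metric.sphere (0 : E) 1, f (e u) ∂(volume : Measure E).toSphere =
      ∫ u : Metric.sphere (0 : E) 1, f u ∂(volume : Measure E).toSphere := by
  let T : Metric.sphere (0 : E) 1 ≃ₜ Metric.sphere (0 : E) 1 :=
    e.toHomeomorph.subtype fun x => by simp
  have hT : MeasurePreserving T (volume : Measure E).toSphere (volume : Measure E).toSphere := by
    refine ⟨T.continuous.measurable, Measure.ext fun s hs => ?_⟩
    rw [Measure.map_apply T.continuous.measurable hs,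
      Measure.toSphere_apply' _ (T.continuous.measurable hs), Measure.toSphere_apply' _ hs]
    congr 1
    have himg : Set.Ioo (0 : ℝ) 1 • ((↑) '' (T ⁻¹' s) : Set E) =
        e ⁻¹' (Set.Ioo (0 : ℝ) 1 • ((↑) '' s)) := by
      ext x
      simp only [Set.mem_smul, Set.mem_image, Set.mem_preimage]
      constructor
      · rintro ⟨c, hc, _, ⟨u, hu, rfl⟩, rfl⟩
        exact ⟨c, hc, e u, ⟨T u, hu, rfl⟩, by simp⟩
      · rintro ⟨c, hc, _, ⟨u, hu, rfl⟩, hx⟩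
        refine ⟨c, hc, _, ⟨T.symm u, by simpa using hu, rfl⟩, e.injective ?_⟩
        rw [← hx, map_smul]
        congr 1
        exact congrArg Subtype.val (T.apply_symm_apply u)
    rw [himg]
    exact e.measurePreserving.measure_preimage_equiv (f := e.toMeasurableEquiv) _
  exact hT.integral_comp T.measurableEmbedding (fun u => f u)

/-- The rotation `(x, y) ↦ (-y, x)` of the plane. -/
noncomputable def quarterTurn : EuclideanSpace ℝ (Fin 2) ≃ₗᵢ[ℝ] EuclideanSpace ℝ (Fin 2) :=
  (LinearIsometryEquiv.piLpCongrLeft 2 ℝ ℝ (Equiv.swap (0 : Fin 2) 1)).trans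
    (LinearIsometryEquiv.piLpCongrRight 2 fun i : Fin 2 =>
      if i = 0 then LinearIsometryEquiv.neg ℝ else LinearIsometryEquiv.refl ℝ ℝ)

theorem quarterTurn_apply_zero (x : EuclideanSpace ℝ (Fin 2)) : quarterTurn x 0 = -x 1 := by
  simp [quarterTurn]

theorem quarterTurn_apply_one (x : EuclideanSpace ℝ (Fin 2)) : quarterTurn x 1 = x 0 := by
  simp [quarterTurn]

theorem integral_circle_eq_zero_of_quarterTurn (f : EuclideanSpace ℝ (Fin 2) → ℝ)
    (hf : ∀ x, f (quarterTurn x) = -f x) :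
    ∫ u : Metric.sphere (0 : EuclideanSpace ℝ (Fin 2)) 1, f u
      ∂(volume : Measure (EuclideanSpace ℝ (Fin 2))).toSphere = 0 := by
  have h := integral_toSphere_comp_linearIsometryEquiv quarterTurn f
  simp only [hf, integral_neg] at h
  linarith

/-- The polynomials `x² - y²` and `x y` have average `0` over the circle, since a quarter turn changes
their sign. They are the real part and half the imaginary part of `(x + i y)²`. -/
theorem IsSphericalDesign.sum_sq_eq_zero {Y : Finset (EuclideanSpace ℝ (Fin 2))}
    (h : IsSphericalDesign 2 (Y : Set (EuclideanSpace ℝ (Fin 2)))) :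
    ∑ x ∈ Y, (⟨x 0, x 1⟩ : ℂ) ^ 2 = 0 := by
  obtain ⟨Z, hZ, hne, r, hr, -, hf⟩ := h
  obtain rfl := Finset.coe_injective hZ
  have hcard : (Z.card : ℝ) ≠ 0 := Nat.cast_ne_zero.2 (Finset.card_ne_zero.2 hne)
  have key : ∀ f : MvPolynomial (Fin 2) ℝ, f.totalDegree ≤ 2 →
      (∀ x : EuclideanSpace ℝ (Fin 2), MvPolynomial.eval (fun i => quarterTurn x i) f =
        -MvPolynomial.eval (fun i => x i) f) →
      ∑ x ∈ Z, MvPolynomial.eval (fun i => x i / r) f = 0 := by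
    intro f hdeg hq
    have h1 := hf f hdeg
    rw [integral_circle_eq_zero_of_quarterTurn
      (fun x => MvPolynomial.eval (fun i => x i) f) hq, mul_zero] at h1
    exact (mul_eq_zero.1 h1).resolve_left (one_div_ne_zero hcard)
  have h1 := key (MvPolynomial.X 0 ^ 2 - MvPolynomial.X 1 ^ 2)
    ((MvPolynomial.totalDegree_sub _ _).trans (by simp [MvPolynomial.totalDegree_X_pow]))
    (fun x => by simp [quarterTurn_apply_zero, quarterTurn_apply_one])
  have h2 := key (MvPolynomial.X 0 * MvPolynomial.X 1)
    ((MvPolynomial.totalDegree_mul _ _).trans (by simp [MvPolynomial.totalDegree_X]))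
    (fun x => by simp [quarterTurn_apply_zero, quarterTurn_apply_one]; ring)
  simp only [map_sub, map_mul, map_pow, MvPolynomial.eval_X, div_pow, ← sub_div,
    div_mul_div_comm, ← Finset.sum_div] at h1 h2
  have hr2 : r ^ 2 ≠ 0 := by positivity
  have hrr : r * r ≠ 0 := by positivity
  replace h1 := (div_eq_zero_iff.1 h1).resolve_right hr2
  replace h2 := (div_eq_zero_iff.1 h2).resolve_right hrr
  apply Complex.ext
  · rw [Complex.re_sum, Complex.zero_re, ← h1]
    exact Finset.sum_congr rfl fun x _ => by simp [pow_two]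
  · rw [Complex.im_sum, Complex.zero_im, ← mul_zero (2 : ℝ), ← h2, Finset.mul_sum]
    exact Finset.sum_congr rfl fun x _ => by simp [pow_two]; ring

/-! ### Shells of ideal lattices -/

section Shells

open FractionalIdeal

/-- A shell of a rescaled fractional ideal consists of the elements of a given norm, and a design would
make the sum of their squares vanish. -/
theorem shell_not_isSphericalDesign {d : ℕ}
    (hsum : ∀ (I : FractionalIdeal (𝓞 (imagQuadField d))⁰ (imagQuadField d)), I ≠ 0 →
      ∀ m : imagQuadField d, m ≠ 0 → ∀ Y : Finset (imagQuadField d),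
        (∀ x, x ∈ Y ↔ x ∈ I ∧ x * conjField d x = m) → Y.Nonempty → ∑ x ∈ Y, x ^ 2 ≠ 0)
    (I : FractionalIdeal (𝓞 (imagQuadField d))⁰ (imagQuadField d)) (hI : I ≠ 0) {c : ℝ}
    (hc : c ≠ 0) (Λ : AddSubgroup (EuclideanSpace ℝ (Fin 2)))
    (hΛ : ∀ v, v ∈ Λ ↔ ∃ z ∈ I, c • planeEmbedding d z = v) {m : ℝ} (hm : 0 < m)
    (hne : (shell Λ m).Nonempty) : ¬ IsSphericalDesign 2 (shell Λ m) := by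
  classical
  intro hdes
  obtain ⟨Y, hY, -⟩ := id hdes
  rw [← hY] at hdes hne
  have hemb0 : ∀ z, (c • planeEmbedding d z) 0 = c * (z : ℂ).re := fun z => by
    simp [planeEmbedding]
  have hemb1 : ∀ z, (c • planeEmbedding d z) 1 = c * (z : ℂ).im := fun z => by
    simp [planeEmbedding]
  have hinner : ∀ z, inner ℝ (c • planeEmbedding d z) (c • planeEmbedding d z) =
      c ^ 2 * Complex.normSq (z : ℂ) := fun z => by
    rw [PiLp.inner_apply, Fin.sum_univ_two, hemb0, hemb1, Complex.normSq_apply]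
    simp only [RCLike.inner_apply, conj_trivial]
    ring
  have hinj : Function.Injective fun z : imagQuadField d => c • planeEmbedding d z := by
    intro z w h
    have h0 := congrArg (fun v : EuclideanSpace ℝ (Fin 2) => v 0) h
    have h1 := congrArg (fun v : EuclideanSpace ℝ (Fin 2) => v 1) h
    simp only [hemb0, hemb1] at h0 h1
    exact Subtype.ext (Complex.ext (mul_left_cancel₀ hc h0) (mul_left_cancel₀ hc h1))
  have hYmem : ∀ v, v ∈ Y ↔ ∃ z ∈ I, c ^ 2 * Complex.normSq (z : ℂ) = m ∧
      c • planeEmbedding d z = v := fun v => by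
    rw [← Finset.mem_coe, hY]
    constructor
    · rintro ⟨h1, h2⟩
      obtain ⟨z, hz, rfl⟩ := (hΛ v).1 h1
      exact ⟨z, hz, by rw [← hinner, h2], rfl⟩
    · rintro ⟨z, hz, h2, rfl⟩
      exact ⟨(hΛ _).2 ⟨z, hz, rfl⟩, by rw [hinner, h2]⟩
  obtain ⟨v₀, hv₀⟩ := hne
  obtain ⟨z₀, hz₀, hz₀m, -⟩ := (hYmem v₀).1 hv₀
  let Z : Finset (imagQuadField d) := Y.preimage _ hinj.injOn
  have hc2 : c ^ 2 ≠ 0 := pow_ne_zero 2 hc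
  have hZ : ∀ z, z ∈ Z ↔ z ∈ I ∧ z * conjField d z = z₀ * conjField d z₀ := fun z => by
    have hiff : z * conjField d z = z₀ * conjField d z₀ ↔ c ^ 2 * Complex.normSq (z : ℂ) = m := by
      rw [← hz₀m, mul_right_inj' hc2, ← Complex.ofReal_inj, ← coe_mul_conjField,
        ← coe_mul_conjField, Subtype.coe_inj]
    rw [hiff, Finset.mem_preimage, hYmem]
    constructor
    · rintro ⟨w, hw, h1, h2⟩
      obtain rfl := hinj h2
      exact ⟨hw, h1⟩
    · rintro ⟨h1, h2⟩
      exact ⟨z, h1, h2, rfl⟩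
  have hz₀0 : z₀ ≠ 0 := by
    rintro rfl
    simp at hz₀m
    exact hm.ne hz₀m
  refine hsum I hI _ (mul_ne_zero hz₀0 (by simpa using hz₀0)) Z hZ
    ⟨z₀, (hZ z₀).2 ⟨hz₀, rfl⟩⟩ (Subtype.ext ?_)
  have h0 := hdes.sum_sq_eq_zero
  have h1 : ∑ v ∈ Y, (⟨v 0, v 1⟩ : ℂ) ^ 2 = (c : ℂ) ^ 2 * ∑ z ∈ Z, (z : ℂ) ^ 2 := by
    rw [Finset.mul_sum]
    symm
    refine Finset.sum_bij (fun z _ => c • planeEmbedding d z)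
      (fun z hz => by simpa [Z] using hz) (fun z _ w _ h => hinj h) (fun v hv => ?_)
      (fun z _ => ?_)
    · obtain ⟨z, hz, h1, rfl⟩ := (hYmem v).1 hv
      exact ⟨z, Finset.mem_preimage.2 hv, rfl⟩
    · rw [hemb0, hemb1, ← mul_pow]
      congr 1
      apply Complex.ext <;> simp
  rw [h1] at h0
  have h2 := (mul_eq_zero.1 h0).resolve_left (pow_ne_zero 2 (by exact_mod_cast hc))
  simpa using h2

end Shells

theorem theorem1p6 (d : ℕ) (hd : 0 < d) (hsq : Squarefree d)
    (h : NumberField.classNumber (imagQuadField d) = 2 ∨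
      d ∈ ({5, 6, 10, 13, 15, 22, 35, 37, 51, 58, 91, 115, 123, 187, 235, 267, 403, 427} :
        Finset ℕ)) :
    (∀ m : ℝ, 0 < m → (shell (integersLattice d) m).Nonempty →
      ¬ IsSphericalDesign 2 (shell (integersLattice d) m)) ∧
    (∀ A : (FractionalIdeal (𝓞 (imagQuadField d))⁰ (imagQuadField d))ˣ,
      ClassGroup.mk (imagQuadField d) A ≠ 1 →
      ∀ m : ℝ, 0 < m → (shell (idealLattice d A) m).Nonempty →
        ¬ IsSphericalDesign 2 (shell (idealLattice d A) m)) := by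
  obtain ⟨ω, T, n, hre, him, hn, hTn⟩ := exists_integral_generator d hd
  -- For `d = 1` and `d = 3` the class number is `1`.
  have hd13 : d ≠ 1 ∧ d ≠ 3 := by
    rcases h with h | h
    · by_contra hcon
      have hPID := isPrincipalIdealRing_of_discr_le_four hre him hn (by
        rcases hTn with ⟨h1, rfl, h2⟩ | ⟨h1, rfl, h2⟩ <;> lia)
      have := classNumber_eq_one_iff.2 hPID
      lia
    · constructor <;> rintro rfl <;> simp at h
  have hclass : ∀ P : IsDedekindDomain.HeightOneSpectrum (𝓞 (imagQuadField d)),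
      ∃ u : imagQuadField d, u ≠ 0 ∧ FractionalIdeal.spanSingleton (𝓞 (imagQuadField d))⁰ u *
        (P.asIdeal : FractionalIdeal (𝓞 (imagQuadField d))⁰ (imagQuadField d)) =
        (comapPrime (conjInt d) P).asIdeal := fun P => by
    rcases h with h | h
    · exact conj_class_of_classNumber_eq_two h P
    · exact exists_spanSingleton_mul_eq_comapPrime P hre him hn (reduced_forms_ambiguous h hTn)
  have hsum := sum_sq_ne_zero_of_conj_class_eq (conjField d) (conjInt d) algebraMap_conjInt
    conjField_conjField (eq_one_or_neg_one_of_mul_conjField hd hsq hd13.1 hd13.2)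
    (fun u hu h1 h2 => mul_conjField_eq_one_of_unit u hu h1 h2) hclass
  refine ⟨fun m hm hne => ?_, fun A _ m hm hne => ?_⟩
  · refine shell_not_isSphericalDesign hsum 1 one_ne_zero one_ne_zero _ (fun v => ?_) hm hne
    rw [integersLattice, AddSubgroup.mem_map]
    simp only [FractionalIdeal.mem_one_iff, one_smul]
    rfl
  · have hA : FractionalIdeal.absNorm
        (A : FractionalIdeal (𝓞 (imagQuadField d))⁰ (imagQuadField d)) ≠ 0 := by
      simp
    have hpos : (0 : ℝ) < FractionalIdeal.absNorm
        (A : FractionalIdeal (𝓞 (imagQuadField d))⁰ (imagQuadField d)) := by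
      exact_mod_cast lt_of_le_of_ne (FractionalIdeal.absNorm_nonneg _) hA.symm
    refine shell_not_isSphericalDesign hsum A A.ne_zero
      (inv_ne_zero (Real.sqrt_pos.2 hpos).ne') _ (fun v => ?_) hm hne
    rw [idealLattice, AddSubgroup.mem_map]
    rfl
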